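/- **Biordered sets.** Let $E$ be a set with a partial binary operation $(e,f)\mapsto ef$. Put $e\,\omega^l f$ if $ef$ is defined and $ef=e$, and $e\,\omega^r f$ if $fe$ is defined and $fe=e$; let $\omega=\omega^l\cap\omega^r$, $\mathcal L=\omega^l\cap(\omega^l)^{-1}$, $\mathcal R=\omega^r\cap(\omega^r)^{-1}$, $\omega^l(e)=\{f: f\,\omega^l e\}$ and $\omega^r(e)=\{f: f\,\omega^r e\}$. For $e,f\in E$ let $M(e,f)=\omega^l(e)\cap\omega^r(f)$, and let the sandwich set be $$S(e,f)=\{h\in M(e,f): eg\,\omega^r\,eh \text{ and } gf\,\omega^l\,hf\text{ for all } g\in M(e,f)\}.$$ $E$ is a *biordered set* if the following axioms and their left-right duals hold for all $e,f,g\in E$: - (B1) $\omega^l$ and $\omega^r$ are reflexive and transitive, and $ef$ is defined if and only if one of $e\,\omega^r f$, $e\,\omega^l f$, $f\,\omega^r e$, $f\,\omega^l e$ holds; - (B21) if $f\,\omega^r e$, then $f\,\mathcal R\,fe\,\omega\,e$; - (B22) if $g\,\omega^l f$ and $f,g\in\omega^r(e)$, then $ge\,\omega^l fe$; - (B31) if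 $g\,\omega^r f\,\omega^r e$, then $gf=(ge)f$; - (B32) if $g\,\omega^l f$ and $f,g\in\omega^r(e)$, then $(fg)e=(fe)(ge)$; - (B4) if $f,g\in\omega^r(e)$, then $S(f,g)e=S(fe,ge)$. It is *regular* if $S(e,f)\neq\emptyset$ for all $e,f\in E$. The set $E/\mathcal L$ of $\mathcal L$-classes $\mathcal L(e)$ is partially ordered by $\mathcal L(e)\le\mathcal L(f)\iff e\,\omega^l f$. **Conditions.** Let $E$ be a regular biordered set such that - (E1) there is an element $0\in E$ with $0\,\omega\,e$ for all $e\in E$; - (E2) there is a map $e\mapsto e'$ of $E$ into itself such that, for all $e,f\in E$: (i) $e''=e$; (ii) $f\,\omega^l e$ if and only if $e'\,\omega^r f'$; (iii) $f\,\omega^l e'$ if and only if $M(f,e)=\{0\}$; - (E3) if $f\,\omega\,e'$, then $S(e',f')\cap S(f',e')\ne\emptyset$. For $f\,\omega\,e'$, write $e\oplus f$ for $h'$, where $h$ is the (unique) element of $S(e',f')\cap S(f',e')$. Sums of several elements are bracketed from the left: $e_1\oplus\dots\oplus e_n=(e_1\oplus\dots\oplus e_{n-1})\oplus e_n$, and the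 sum is $e_1$ for $n=1$. **Proposition 5.5.** Let $n\ge1$ and let $e_1,\dots,e_n\in E$ satisfy $M(e_i,e_j)=\{0\}$ for all $i\neq j$. Then $\mathcal L(e_1),\dots,\mathcal L(e_n)$ are independent in $E/\mathcal L$: for each $i$, the join $\bigvee_{j\ne i}\mathcal L(e_j)$ exists and $$\mathcal L(e_i)\wedge\bigvee_{j\neq i}\mathcal L(e_j)=\mathcal L(0),$$ where $\mathcal L(0)$ is the least element of $E/\mathcal L$ (an empty join is $\mathcal L(0)$). Moreover $e_1\oplus\dots\oplus e_n$ is defined, is uniquely determined, and $$\mathcal L(e_1)\vee\dots\vee\mathcal L(e_n)=\mathcal L(e_1\oplus\dots\oplus e_n).$$ -/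

import Mathlib

/-- A set with a partial binary operation: `op e f = some g` means that the product `ef` is
defined and equal to `g`, and `op e f = none` means that `ef` is not defined. -/
class PartialAlgebra (E : Type*) where
  /-- the partial product -/
  op : E → E → Option E

namespace Biorder

open PartialAlgebra

section Relations

variable {E : Type*} [PartialAlgebra E]

/-- `e ω^l f`: the product `ef` is defined and equals `e`. -/
def OmegaL (e f : E) : Prop := op e f = some e

/-- `e ω^r f`: the product `fe` is defined and equals `e`. -/
def OmegaR (e f : E) : Prop := op f e = some e

/-- `ω = ω^l ∩ ω^r`. -/
def Omega (e f : E) : Prop := OmegaL e f ∧ OmegaR e f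

/-- Green's relation `L = ω^l ∩ (ω^l)⁻¹`. -/
def GreenL (e f : E) : Prop := OmegaL e f ∧ OmegaL f e

/-- Green's relation `R = ω^r ∩ (ω^r)⁻¹`. -/
def GreenR (e f : E) : Prop := OmegaR e f ∧ OmegaR f e

/-- `M(e,f) = ω^l(e) ∩ ω^r(f)`. -/
def MSet (e f : E) : Set E := {g | OmegaL g e ∧ OmegaR g f}

/-- The relation `g ≼ h` on `M(e,f)`: `eg ω^r eh` and `gf ω^l hf` (with all four products
defined, as is automatic in a biordered set for `g, h` in `M(e,f)`). -/
def SandwichLE (e f g h : E) : Prop :=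
  (∃ a b, op e g = some a ∧ op e h = some b ∧ OmegaR a b) ∧
  (∃ c d, op g f = some c ∧ op h f = some d ∧ OmegaL c d)

/-- The sandwich set `S(e,f) = {h ∈ M(e,f) : g ≼ h for all g ∈ M(e,f)}`. -/
def SandwichSet (e f : E) : Set E := {h | h ∈ MSet e f ∧ ∀ g ∈ MSet e f, SandwichLE e f g h}

end Relations

/-- A biordered set: a partial algebra satisfying Nambooripad's axioms
(B1), (B21), (B22), (B31), (B32), (B4) and their duals (the primed fields). -/
class BiorderedSet (E : Type*) extends PartialAlgebra E where
  /-- (B1): `ω^l` and `ω^r` are quasi-orders. -/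
  omegaL_refl : ∀ e : E, OmegaL e e
  omegaR_refl : ∀ e : E, OmegaR e e
  omegaL_trans : ∀ e f g : E, OmegaL e f → OmegaL f g → OmegaL e g
  omegaR_trans : ∀ e f g : E, OmegaR e f → OmegaR f g → OmegaR e g
  /-- (B1): the domain of the product is `(ω^r ∪ ω^l) ∪ (ω^r ∪ ω^l)⁻¹`. -/
  domain : ∀ e f : E, (∃ p, op e f = some p) ↔
    (OmegaR e f ∨ OmegaL e f) ∨ (OmegaR f e ∨ OmegaL f e)
  /-- (B21): `f ω^r e` implies `f R fe ω e`. -/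
  b21 : ∀ e f : E, OmegaR f e → ∃ p, op f e = some p ∧ GreenR f p ∧ Omega p e
  b21' : ∀ e f : E, OmegaL f e → ∃ p, op e f = some p ∧ GreenL f p ∧ Omega p e
  /-- (B22): `g ω^l f` and `f, g ∈ ω^r(e)` imply `ge ω^l fe`. -/
  b22 : ∀ e f g : E, OmegaL g f → OmegaR f e → OmegaR g e →
    ∃ p q, op g e = some p ∧ op f e = some q ∧ OmegaL p q
  b22' : ∀ e f g : E, OmegaR g f → OmegaL f e → OmegaL g e →
    ∃ p q, op e g = some p ∧ op e f = some q ∧ OmegaR p q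
  /-- (B31): `g ω^r f ω^r e` implies `gf = (ge)f`. -/
  b31 : ∀ e f g : E, OmegaR g f → OmegaR f e →
    ∃ p q, op g e = some p ∧ op g f = some q ∧ op p f = some q
  b31' : ∀ e f g : E, OmegaL g f → OmegaL f e →
    ∃ p q, op e g = some p ∧ op f g = some q ∧ op f p = some q
  /-- (B32): `g ω^l f` and `f, g ∈ ω^r(e)` imply `(fg)e = (fe)(ge)`. -/
  b32 : ∀ e f g : E, OmegaL g f → OmegaR f e → OmegaR g e →
    ∃ p q r s, op f g = some p ∧ op f e = some q ∧ op g e = some r ∧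
      op p e = some s ∧ op q r = some s
  b32' : ∀ e f g : E, OmegaR g f → OmegaL f e → OmegaL g e →
    ∃ p q r s, op g f = some p ∧ op e f = some q ∧ op e g = some r ∧
      op e p = some s ∧ op r q = some s
  /-- (B4): `f, g ∈ ω^r(e)` implies `S(f,g)e = S(fe,ge)`. -/
  b4 : ∀ e f g : E, OmegaR f e → OmegaR g e → ∃ p q, op f e = some p ∧ op g e = some q ∧
    {k : E | ∃ h ∈ SandwichSet f g, op h e = some k} = SandwichSet p q
  b4' : ∀ e f g : E, OmegaL f e → OmegaL g e → ∃ p q, op e f = some p ∧ op e g = some q ∧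
    {k : E | ∃ h ∈ SandwichSet f g, op e h = some k} = SandwichSet p q

/-- A biordered set is regular if all its sandwich sets are non-empty. -/
def IsRegular (E : Type*) [BiorderedSet E] : Prop :=
  ∀ e f : E, (SandwichSet e f).Nonempty

section Quotient

variable (E : Type*) [BiorderedSet E]

/-- Green's relation `L` as a setoid. -/
def greenLSetoid : Setoid E where
  r := GreenL
  iseqv :=
    { refl := fun e => ⟨BiorderedSet.omegaL_refl e, BiorderedSet.omegaL_refl e⟩
      symm := fun h => ⟨h.2, h.1⟩
      trans := fun h k => ⟨BiorderedSet.omegaL_trans _ _ _ h.1 k.1,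
        BiorderedSet.omegaL_trans _ _ _ k.2 h.2⟩ }

/-- The set `E / L` of `L`-classes. -/
def LQuotient : Type _ := Quotient (greenLSetoid E)

variable {E}

/-- The `L`-class `L(e)` of `e`. -/
def lClass (e : E) : LQuotient E := Quotient.mk (greenLSetoid E) e

/-- The order of `E / L`: `L(e) ≤ L(f)` if and only if `e ω^l f`. -/
instance : PartialOrder (LQuotient E) where
  le := Quotient.lift₂ (s₁ := greenLSetoid E) (s₂ := greenLSetoid E) OmegaL
    (fun _ _ _ _ h k => propext
      ⟨fun u => BiorderedSet.omegaL_trans _ _ _ h.2 (BiorderedSet.omegaL_trans _ _ _ u k.1),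
       fun u => BiorderedSet.omegaL_trans _ _ _ h.1 (BiorderedSet.omegaL_trans _ _ _ u k.2)⟩)
  le_refl := fun a => Quotient.inductionOn a BiorderedSet.omegaL_refl
  le_trans := fun a b c => Quotient.inductionOn₃ a b c BiorderedSet.omegaL_trans
  le_antisymm := fun a b => Quotient.inductionOn₂ a b
    (fun _ _ h k => Quotient.sound (s := greenLSetoid E) ⟨h, k⟩)

theorem lClass_le_lClass {e f : E} : lClass e ≤ lClass f ↔ OmegaL e f := Iff.rfl

end Quotient

/-- Independence of a finite family in a partially ordered set with least element `z`: for each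
`i` the join of the `a j` with `j ≠ i` exists, and its meet with `a i` exists and is `z`. -/
def IsIndependent {P ι : Type*} [PartialOrder P] (z : P) (a : ι → P) : Prop :=
  IsLeast Set.univ z ∧
    ∀ i, ∃ b, IsLUB {x | ∃ j, j ≠ i ∧ x = a j} b ∧ IsGLB {a i, b} z

/-- `s = e ⊕ f` relative to the complementation `c`: `e ⊕ f` is defined when `f ω c e`, and then
`s = c h` for the (unique) `h` in `S(c e, c f) ∩ S(c f, c e)`. -/
def IsOplus {E : Type*} [PartialAlgebra E] (c : E → E) (e f s : E) : Prop :=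
  Omega f (c e) ∧ ∃ h ∈ SandwichSet (c e) (c f) ∩ SandwichSet (c f) (c e), s = c h

/-- `s = e 0 ⊕ e 1 ⊕ ⋯ ⊕ e n = (⋯(e 0 ⊕ e 1) ⊕ ⋯) ⊕ e n`: `t i` are the partial sums. -/
def IsIteratedOplus {E : Type*} [PartialAlgebra E] (c : E → E) {n : ℕ} (e : Fin (n + 1) → E)
    (s : E) : Prop :=
  ∃ t : Fin (n + 1) → E, t 0 = e 0 ∧
    (∀ i : Fin n, IsOplus c (t i.castSucc) (e i.succ) (t i.succ)) ∧ t (Fin.last n) = s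

end Biorder

namespace Biorder

open PartialAlgebra BiorderedSet

section General

variable {E : Type*} [BiorderedSet E]

/-! Call `a`, `b` orthogonal when `a ω b'`; this is symmetric since `'` is an involution exchanging
`ω^l` and reversed `ω^r`. An `h ∈ S(a',b') ∩ S(b',a')` is a meet of `a'` and `b'` both for `ω` (so
it is unique) and for the quasi-order `ω^r`. Complementing the `ω^r`-meet makes `a ⊕ b = h'` a join
for `ω^l`; the `ω`-meet says that whatever is orthogonal to `a` and `b` is orthogonal to `a ⊕ b`, so
orthogonal sums can be iterated. For independence, let `s` be the sum of the other terms. If `x ω^l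
e_i` and `x ω^l s`, then `s ω^l e_i'` gives `M(x,e_i) = {0}`, which forces `x ω^l 0`. -/

theorem Omega.trans {e f g : E} (h : Omega e f) (k : Omega f g) : Omega e g :=
  ⟨omegaL_trans _ _ _ h.1 k.1, omegaR_trans _ _ _ h.2 k.2⟩

theorem Omega.antisymm {e f : E} (h : Omega e f) (k : Omega f e) : e = f := by
  have h₁ : op e f = some e := h.1
  have h₂ : op e f = some f := k.2
  exact Option.some.inj (h₁.symm.trans h₂)

/-- If `g, h ω^r e`, then `eg = g` and `eh = h`, so `g ≼ h` gives `g ω^r h`. -/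
theorem SandwichLE.omegaR {e f g h : E} (H : SandwichLE e f g h) (hh : OmegaR h e)
    (hg : OmegaR g e) : OmegaR g h := by
  obtain ⟨⟨a, b, ha, hb, hab⟩, -⟩ := H
  obtain rfl : g = a := Option.some.inj (hg.symm.trans ha)
  obtain rfl : h = b := Option.some.inj (hh.symm.trans hb)
  exact hab

theorem SandwichLE.omegaL {e f g h : E} (H : SandwichLE e f g h) (hh : OmegaL h f)
    (hg : OmegaL g f) : OmegaL g h := by
  obtain ⟨-, ⟨a, b, ha, hb, hab⟩⟩ := H
  obtain rfl : g = a := Option.some.inj (hg.symm.trans ha)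
  obtain rfl : h = b := Option.some.inj (hh.symm.trans hb)
  exact hab

theorem omega_iff_of_mem_sandwichSet_inter {e f h : E}
    (hh : h ∈ SandwichSet e f ∩ SandwichSet f e) (g : E) :
    Omega g h ↔ Omega g e ∧ Omega g f := by
  obtain ⟨⟨⟨hl, hr⟩, H⟩, ⟨⟨hl', hr'⟩, -⟩⟩ := hh
  refine ⟨fun hg => ⟨hg.trans ⟨hl, hr'⟩, hg.trans ⟨hl', hr⟩⟩, fun ⟨he, hf⟩ => ?_⟩
  have hle := H g ⟨he.1, hf.2⟩
  exact ⟨hle.omegaL hl' hf.1, hle.omegaR hr' he.2⟩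

theorem omegaR_iff_of_mem_sandwichSet_inter {e f h : E}
    (hh : h ∈ SandwichSet e f ∩ SandwichSet f e) (g : E) :
    OmegaR g h ↔ OmegaR g e ∧ OmegaR g f := by
  obtain ⟨⟨⟨hl, hr⟩, H⟩, ⟨⟨hl', hr'⟩, -⟩⟩ := hh
  refine ⟨fun hg => ⟨omegaR_trans _ _ _ hg hr', omegaR_trans _ _ _ hg hr⟩, fun ⟨he, hf⟩ => ?_⟩
  -- `g` need not lie in `M(e,f)`, as `g ω^l e` may fail; its `R`-equivalent `p = ge` satisfies `p ω
  -- e` and does lie there.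
  obtain ⟨p, -, hgp, hpe⟩ := b21 e g he
  have hp := H p ⟨hpe.1, omegaR_trans _ _ _ hgp.2 hf⟩
  exact omegaR_trans _ _ _ hgp.1 (hp.omegaR hr' hpe.2)

theorem eq_of_mem_sandwichSet_inter {e f h k : E} (hh : h ∈ SandwichSet e f ∩ SandwichSet f e)
    (hk : k ∈ SandwichSet e f ∩ SandwichSet f e) : h = k := by
  have refl : ∀ g : E, Omega g g := fun g => ⟨omegaL_refl g, omegaR_refl g⟩
  exact Omega.antisymm
    ((omega_iff_of_mem_sandwichSet_inter hk h).2
      ((omega_iff_of_mem_sandwichSet_inter hh h).1 (refl h)))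
    ((omega_iff_of_mem_sandwichSet_inter hh k).2
      ((omega_iff_of_mem_sandwichSet_inter hk k).1 (refl k)))

/-- If `x ω^l e` and `M(x, e)` contains only `z`, then `x ω^l z`. -/
theorem omegaL_of_mSet_eq_singleton {x e z : E} (hx : OmegaL x e) (hM : MSet x e = {z}) :
    OmegaL x z := by
  -- `p = ex` is `L`-equivalent to `x` and below `e`, hence in `M(x,e)`.
  obtain ⟨p, -, hxp, hpe⟩ := b21' e x hx
  have hp : p ∈ MSet x e := ⟨hxp.2, hpe.2⟩
  rw [hM, Set.mem_singleton_iff] at hp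
  exact hp ▸ hxp.1

/-- Moves joins in `E / L` down to `E`, where the induction on sums takes place. -/
theorem isLUB_range_lClass_iff {ι : Type*} {e : ι → E} {s : E} :
    IsLUB (Set.range fun i => lClass (e i)) (lClass s) ↔
      ∀ x, OmegaL s x ↔ ∀ i, OmegaL (e i) x := by
  constructor
  · intro h x
    rw [← lClass_le_lClass, isLUB_le_iff h, mem_upperBounds, Set.forall_mem_range]
    rfl
  · intro h
    refine ⟨?_, fun b => ?_⟩
    · rintro _ ⟨i, rfl⟩
      exact (h s).1 (omegaL_refl s) i
    · refine Quotient.inductionOn b fun x hx => (h x).2 fun i => hx ⟨i, rfl⟩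

theorem IsOplus.unique {c : E → E} {e f s t : E} (hs : IsOplus c e f s) (ht : IsOplus c e f t) :
    s = t := by
  obtain ⟨-, h, hh, rfl⟩ := hs
  obtain ⟨-, k, hk, rfl⟩ := ht
  rw [eq_of_mem_sandwichSet_inter hh hk]

theorem IsIteratedOplus.unique {c : E → E} {n : ℕ} {e : Fin (n + 1) → E} {s s' : E}
    (hs : IsIteratedOplus c e s) (hs' : IsIteratedOplus c e s') : s = s' := by
  obtain ⟨t, h0, ht, rfl⟩ := hs
  obtain ⟨t', h0', ht', rfl⟩ := hs'
  suffices ∀ i, t i = t' i from this _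
  intro i
  induction i using Fin.induction with
  | zero => rw [h0, h0']
  | succ i ih => exact (ht i).unique (ih ▸ ht' i)

theorem IsIteratedOplus.snoc {c : E → E} {n : ℕ} {e : Fin (n + 2) → E} {s s' : E}
    (hs : IsIteratedOplus c (fun i => e (Fin.castSucc i)) s)
    (hs' : IsOplus c s (e (Fin.last _)) s') : IsIteratedOplus c e s' := by
  obtain ⟨t, h0, ht, rfl⟩ := hs
  refine ⟨Fin.snoc (α := fun _ => E) t s', ?_, fun i => ?_, by simp⟩
  · rw [← Fin.castSucc_zero, Fin.snoc_castSucc]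
    exact h0
  · induction i using Fin.lastCases with
    | last => simpa only [Fin.succ_last, Fin.snoc_last, Fin.snoc_castSucc] using hs'
    | cast i =>
      rw [Fin.succ_castSucc]
      simpa only [Fin.snoc_castSucc] using ht i

end General

section Complement

variable {E : Type*} [BiorderedSet E] {c : E → E}

theorem IsOplus.omega_compl_iff (hinv : ∀ e, c (c e) = e) {a b s : E} (h : IsOplus c a b s)
    (f : E) : Omega f (c s) ↔ Omega f (c a) ∧ Omega f (c b) := by
  obtain ⟨-, k, hk, rfl⟩ := h
  rw [hinv]
  exact omega_iff_of_mem_sandwichSet_inter hk f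

theorem IsOplus.omegaL_iff (hinv : ∀ e, c (c e) = e)
    (hrev : ∀ e f, OmegaL f e ↔ OmegaR (c e) (c f)) {a b s : E} (h : IsOplus c a b s) (x : E) :
    OmegaL s x ↔ OmegaL a x ∧ OmegaL b x := by
  obtain ⟨-, k, hk, rfl⟩ := h
  rw [hrev, hrev x a, hrev x b, hinv]
  exact omegaR_iff_of_mem_sandwichSet_inter hk (c x)

theorem exists_isOplus
    (hE3 : ∀ e f : E, Omega f (c e) →
      (SandwichSet (c e) (c f) ∩ SandwichSet (c f) (c e)).Nonempty)
    {a b : E} (h : Omega b (c a)) : ∃ s, IsOplus c a b s := by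
  obtain ⟨k, hk⟩ := hE3 a b h
  exact ⟨c k, h, k, hk, rfl⟩

theorem Omega.compl_symm (hinv : ∀ e, c (c e) = e)
    (hrev : ∀ e f, OmegaL f e ↔ OmegaR (c e) (c f)) {a b : E} (h : Omega a (c b)) :
    Omega b (c a) := by
  refine ⟨(hrev _ _).2 ?_, ?_⟩
  · rw [hinv]
    exact h.2
  · have := (hrev _ _).1 h.1
    rwa [hinv] at this

/-- Each hypothesis supplies one half: `hba` gives `b ω^l a'`, while `hab` gives `a ω^l b'`, which
complementation turns into `b ω^r a'`. -/
theorem omega_compl_of_mSet_eq {z : E} (hinv : ∀ e, c (c e) = e)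
    (hrev : ∀ e f, OmegaL f e ↔ OmegaR (c e) (c f))
    (hann : ∀ e f, OmegaL f (c e) ↔ MSet f e = {z}) {a b : E} (hab : MSet a b = {z})
    (hba : MSet b a = {z}) : Omega b (c a) := by
  refine ⟨(hann a b).2 hba, ?_⟩
  have := (hrev (c b) a).1 ((hann b a).2 hab)
  rwa [hinv] at this

/-- The iterated sum of a pairwise orthogonal family exists; its class is the join of the family,
and it is orthogonal to whatever is orthogonal to each member. -/
theorem exists_isIteratedOplus (hinv : ∀ e, c (c e) = e)
    (hrev : ∀ e f, OmegaL f e ↔ OmegaR (c e) (c f))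
    (hE3 : ∀ e f : E, Omega f (c e) →
      (SandwichSet (c e) (c f) ∩ SandwichSet (c f) (c e)).Nonempty) :
    ∀ (n : ℕ) (e : Fin (n + 1) → E), (∀ i j, i ≠ j → Omega (e i) (c (e j))) →
      ∃ s, IsIteratedOplus c e s ∧ (∀ x, OmegaL s x ↔ ∀ i, OmegaL (e i) x) ∧
        ∀ f, (∀ i, Omega f (c (e i))) → Omega f (c s)
  | 0, e, _ => ⟨e 0, ⟨e, rfl, fun i => i.elim0, rfl⟩, fun x => by simp, fun f h => h 0⟩
  | n + 1, e, he => by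
    obtain ⟨s, hs, hsup, horth⟩ := exists_isIteratedOplus hinv hrev hE3 n
      (fun i => e i.castSucc) fun i j hij => he _ _ (by simpa using hij)
    obtain ⟨s', hs'⟩ := exists_isOplus hE3
      -- The last term is orthogonal to every earlier one, hence to their sum.
      (horth (e (Fin.last _)) fun i => he _ _ (Fin.castSucc_lt_last i).ne')
    refine ⟨s', hs.snoc hs', fun x => ?_, fun f hf => ?_⟩
    · rw [hs'.omegaL_iff hinv hrev, hsup]
      exact (Fin.forall_fin_succ' (P := fun i => OmegaL (e i) x)).symm
    · exact (hs'.omega_compl_iff hinv f).2 ⟨horth f fun i => hf _, hf _⟩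

/-- The classes of a pairwise orthogonal family are independent. -/
theorem isIndependent_lClass {z : E} (hz : ∀ e, Omega z e) (hinv : ∀ e, c (c e) = e)
    (hrev : ∀ e f, OmegaL f e ↔ OmegaR (c e) (c f))
    (hann : ∀ e f, OmegaL f (c e) ↔ MSet f e = {z})
    (hE3 : ∀ e f : E, Omega f (c e) →
      (SandwichSet (c e) (c f) ∩ SandwichSet (c f) (c e)).Nonempty)
    {n : ℕ} {e : Fin (n + 1) → E} (he : ∀ i j, i ≠ j → Omega (e i) (c (e j))) :
    IsIndependent (lClass z) fun i => lClass (e i) := by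
  have hbot : ∀ b : LQuotient E, lClass z ≤ b := fun b =>
    Quotient.inductionOn b fun x => (hz x).1
  refine ⟨⟨trivial, fun b _ => hbot b⟩, fun i => ?_⟩
  obtain ⟨s, hs, horth⟩ : ∃ s, IsLUB {x | ∃ j, j ≠ i ∧ x = lClass (e j)} (lClass s) ∧
      Omega s (c (e i)) := by
    have hset : {x | ∃ j, j ≠ i ∧ x = lClass (e j)} =
        Set.range fun j : Fin n => lClass (e (i.succAbove j)) := by
      ext x
      constructor
      · rintro ⟨j, hj, rfl⟩
        obtain ⟨k, rfl⟩ := Fin.exists_succAbove_eq hj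
        exact ⟨k, rfl⟩
      · rintro ⟨k, rfl⟩
        exact ⟨_, Fin.succAbove_ne i k, rfl⟩
    rw [hset]
    -- Iterated sums have at least one term, so the empty join is handled separately, by `z`.
    cases n with
    | zero =>
      refine ⟨z, isLUB_range_lClass_iff.2 fun x => ?_, hz _⟩
      exact ⟨fun _ j => j.elim0, fun _ => (hz x).1⟩
    | succ n =>
      obtain ⟨s, -, hsup, horth⟩ := exists_isIteratedOplus hinv hrev hE3 n
        (fun j => e (i.succAbove j)) fun j k hjk => he _ _ (by simpa using hjk)
      refine ⟨s, isLUB_range_lClass_iff.2 hsup, ?_⟩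
      exact (horth (e i) fun j => he _ _ (Fin.succAbove_ne i j).symm).compl_symm hinv hrev
  refine ⟨lClass s, hs, ?_, fun b hb => ?_⟩
  · exact fun b _ => hbot b
  · revert hb
    refine Quotient.inductionOn b fun x hx => ?_
    have hxi : OmegaL x (e i) := hx (Set.mem_insert _ _)
    have hxs : OmegaL x s := hx (Set.mem_insert_of_mem _ rfl)
    -- `x ω^l s ω^l e_i'` yields `M(x,e_i) = {z}`.
    exact omegaL_of_mSet_eq_singleton hxi ((hann _ _).1 (omegaL_trans _ _ _ hxs horth.1))

end Complement

end Biorder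

theorem proposition5p5 {E : Type*} [Biorder.BiorderedSet E] (hreg : Biorder.IsRegular E)
    (zero : E) (c : E → E)
    (hE1 : ∀ e : E, Biorder.Omega zero e)
    (hE2i : ∀ e : E, c (c e) = e)
    (hE2ii : ∀ e f : E, Biorder.OmegaL f e ↔ Biorder.OmegaR (c e) (c f))
    (hE2iii : ∀ e f : E, Biorder.OmegaL f (c e) ↔ Biorder.MSet f e = {zero})
    (hE3 : ∀ e f : E, Biorder.Omega f (c e) →
      (Biorder.SandwichSet (c e) (c f) ∩ Biorder.SandwichSet (c f) (c e)).Nonempty)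
    (n : ℕ) (e : Fin (n + 1) → E)
    (he : ∀ i j, i ≠ j → Biorder.MSet (e i) (e j) = {zero}) :
    Biorder.IsIndependent (Biorder.lClass zero) (fun i => Biorder.lClass (e i)) ∧
    ∃ s : E, Biorder.IsIteratedOplus c e s ∧
      (∀ s' : E, Biorder.IsIteratedOplus c e s' → s' = s) ∧
      IsLUB (Set.range fun i => Biorder.lClass (e i)) (Biorder.lClass s) := by
  have horth : ∀ i j, i ≠ j → Biorder.Omega (e i) (c (e j)) := fun i j hij =>
    Biorder.omega_compl_of_mSet_eq hE2i hE2ii hE2iii (he j i hij.symm) (he i j hij)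
  refine ⟨Biorder.isIndependent_lClass hE1 hE2i hE2ii hE2iii hE3 horth, ?_⟩
  obtain ⟨s, hs, hsup, -⟩ := Biorder.exists_isIteratedOplus hE2i hE2ii hE3 n e horth
  exact ⟨s, hs, fun s' hs' => hs'.unique hs, Biorder.isLUB_range_lClass_iff.2 hsup⟩
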